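/- Let $(\Omega,\mathcal F,\mathbb P)$ be a probability space, $X\in L^2(\Omega)$, $(X_\ell)_{\ell\ge 0}\subset L^2(\Omega)$ real random variables, $X_{-1}:=0$, $\Delta_\ell X:=X_\ell-X_{\ell-1}$, $V_\ell:=\mathrm{Var}(\Delta_\ell X)$, let $C_\ell\ge 0$ denote the cost of $\Delta_\ell X$, and put $S_k:=\sum_{\ell=0}^k\sqrt{V_\ell C_\ell}$. Suppose there are constants $\alpha,\beta,\gamma,c_\alpha>0$ with $\min(\beta,\gamma)\le 2\alpha$ such that for all $\ell\ge 0$ $$|\mathbb E[X-X_\ell]|\le c_\alpha e^{-\alpha\ell},\qquad V_\ell< K e^{-\beta\ell},\qquad k\,e^{\gamma\ell}<C_\ell<K'e^{\gamma\ell}$$ for some constants $K>0$, $K'>k>0$ independent of $\ell$. Let $\Delta_\ell X^i$ ($\ell\ge 0$, $i\ge 1$) be independent random variables on $\Omega$ such that each $\Delta_\ell X^i$ is distributed as $\Delta_\ell X$. For $\epsilon>0$ let $$L(\epsilon)=\max\Big(\Big\lceil \tfrac{\log(c_\alpha\epsilon^{-1})}{\alpha}\Big\rceil,1\Big),\quad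 M_\ell(\epsilon)=\max\Big(\Big\lceil \epsilon^{-2}\sqrt{V_\ell/C_\ell}\,S_{L(\epsilon)}\Big\rceil,1\Big),\quad \mathcal A(\epsilon)=\sum_{\ell=0}^{L(\epsilon)}\sum_{i=1}^{M_\ell(\epsilon)}\frac{\Delta_\ell X^i}{M_\ell(\epsilon)} .$$ Assume that $\gamma\ge\beta$, that $V_0>0$, and that - if $\beta=\gamma$, then $\lim_{k\to\infty}S_k=\infty$; - if $\gamma>\beta$, then $\beta<2\alpha$ and there is $\upsilon\in[\beta,2\alpha)$ with $\liminf_{k\to\infty}S_k e^{(\upsilon-\gamma)k/2}>1$ (the value $+\infty$ being allowed). Assume further that for every $\nu>0$ $$\lim_{\ell\to\infty}\mathbf 1_{\{V_\ell>0\}}\,\mathbb E\Big[\frac{|\Delta_\ell X-\mathbb E\Delta_\ell X|^2}{V_\ell}\,\mathbf 1_{\big\{\frac{|\Delta_\ell X-\mathbb E\Delta_\ell X|^2}{V_\ell}>\nu e^{(2\alpha-\gamma)\ell}S_\ell^2\big\}}\Big]=0 ,$$ where the expression is understood to be $0$ if $V_\ell=0$. Then the normalized MLMC estimator has the triangular array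 representation $$\frac{\mathcal A(\epsilon)-\mathbb E[X_{L(\epsilon)}]}{\sqrt{\mathrm{Var}(\mathcal A(\epsilon))}}=\sum_{\ell=0}^{L(\epsilon)}\sum_{i=1}^{M_\ell(\epsilon)}Y_{\epsilon,\ell,i},\qquad Y_{\epsilon,\ell,i}:=\frac{\Delta_\ell X^i-\mathbb E\Delta_\ell X}{\sqrt{\mathrm{Var}(\mathcal A(\epsilon))}\,M_\ell(\epsilon)}\qquad(\epsilon>0),$$ and it satisfies the extended CLT condition: as $\epsilon\downarrow 0$, $$\sum_{\ell=0}^{L(\epsilon)}\sum_{i=1}^{M_\ell(\epsilon)}Y_{\epsilon,\ell,i}\xrightarrow{\ d\ }\mathcal N(0,1)\qquad\text{and}\qquad \max_{0\le\ell\le L(\epsilon),\ 1\le i\le M_\ell(\epsilon)}\mathbb E\big[Y_{\epsilon,\ell,i}^2\big]\to 0 .$$ -/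

import Mathlib

open MeasureTheory ProbabilityTheory Filter Topology

namespace MLMC

noncomputable section

/-- `f = 𝒪_ℓ(y)`: `|f ℓ| < K |y ℓ|` for all levels `ℓ`, with one constant `K > 0`. -/
def IsBigOLevel (f y : ℕ → ℝ) : Prop :=
  ∃ K : ℝ, 0 < K ∧ ∀ ℓ, |f ℓ| < K * |y ℓ|

/-- `f = Θ_ℓ(y)`: `k |y ℓ| < |f ℓ| < K |y ℓ|` for all levels `ℓ`, with constants `K > k > 0`. -/
def IsThetaLevel (f y : ℕ → ℝ) : Prop :=
  ∃ k K : ℝ, 0 < k ∧ k < K ∧ ∀ ℓ, k * |y ℓ| < |f ℓ| ∧ |f ℓ| < K * |y ℓ|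

/-- The level differences `Δ_ℓ X = X_ℓ - X_{ℓ-1}`, with `X_{-1} = 0`. -/
def levelDiff {Ω : Type*} (X : ℕ → Ω → ℝ) : ℕ → Ω → ℝ
  | 0 => X 0
  | ℓ + 1 => fun ω => X (ℓ + 1) ω - X ℓ ω

variable {Ω : Type*} [MeasurableSpace Ω]

/-- `V_ℓ = Var(Δ_ℓ X)`. -/
def levelVar (P : Measure Ω) (X : ℕ → Ω → ℝ) (ℓ : ℕ) : ℝ :=
  variance (levelDiff X ℓ) P

/-- `S_k = ∑_{ℓ ≤ k} √(V_ℓ C_ℓ)`. -/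
def levelSum (P : Measure Ω) (X : ℕ → Ω → ℝ) (C : ℕ → ℝ) (k : ℕ) : ℝ :=
  ∑ ℓ ∈ Finset.range (k + 1), Real.sqrt (levelVar P X ℓ * C ℓ)

/-- The rate assumption: the random variable `Xlim`, its approximations `X ℓ` (`ℓ ≥ 0`) and the
costs `C ℓ = Cost(Δ_ℓ X)` satisfy the bias, variance and cost rates. -/
structure RateAssumption (P : Measure Ω) (Xlim : Ω → ℝ) (X : ℕ → Ω → ℝ) (C : ℕ → ℝ)
    (α β γ cα : ℝ) : Prop where
  memLp_lim : MemLp Xlim 2 P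
  memLp : ∀ ℓ, MemLp (X ℓ) 2 P
  alpha_pos : 0 < α
  beta_pos : 0 < β
  gamma_pos : 0 < γ
  calpha_pos : 0 < cα
  min_le : min β γ ≤ 2 * α
  bias : ∀ ℓ : ℕ, |∫ ω, (Xlim ω - X ℓ ω) ∂P| ≤ cα * Real.exp (-α * ℓ)
  var_rate : IsBigOLevel (levelVar P X) (fun ℓ => Real.exp (-β * ℓ))
  cost_nonneg : ∀ ℓ, 0 ≤ C ℓ
  cost_rate : IsThetaLevel C (fun ℓ => Real.exp (γ * ℓ))

/-- The additional variance decay assumption. The lower limit is taken in the extended reals, so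
that the value `+∞` is allowed. -/
structure VarianceDecayAssumption (P : Measure Ω) (X : ℕ → Ω → ℝ) (C : ℕ → ℝ)
    (α β γ : ℝ) : Prop where
  var_zero_pos : 0 < levelVar P X 0
  of_eq : β = γ → Tendsto (levelSum P X C) atTop atTop
  of_lt : β < γ → β < 2 * α ∧ ∃ υ : ℝ, β ≤ υ ∧ υ < 2 * α ∧
    (1 : EReal) < liminf
      (fun k : ℕ => ((levelSum P X C k * Real.exp ((υ - γ) * k / 2) : ℝ) : EReal)) atTop

/-- Samples `D ℓ i` (of `Δ_ℓ X`): all of them are independent, and `D ℓ i` has the law of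
`Δ_ℓ X`. The samples of one level are numbered `i = 0, 1, 2, …`. -/
structure IsSampling (P : Measure Ω) (X : ℕ → Ω → ℝ) (D : ℕ → ℕ → Ω → ℝ) : Prop where
  indep : iIndepFun (fun p : ℕ × ℕ => D p.1 p.2) P
  identDistrib : ∀ ℓ i, IdentDistrib (D ℓ i) (levelDiff X ℓ) P P

/-- The number of levels `L(ε) = max(⌈log(cα / ε) / α⌉, 1)`. -/
def numLevels (α cα ε : ℝ) : ℕ :=
  max ⌈Real.log (cα * ε⁻¹) / α⌉₊ 1

/-- The number of samples
`M_ℓ(ε) = max(⌈ε⁻² √(V_ℓ / C_ℓ) S_{L(ε)}⌉, 1)` on level `ℓ`. -/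
def numSamples (P : Measure Ω) (X : ℕ → Ω → ℝ) (C : ℕ → ℝ) (α cα ε : ℝ) (ℓ : ℕ) : ℕ :=
  max ⌈(ε ^ 2)⁻¹ * Real.sqrt (levelVar P X ℓ / C ℓ) * levelSum P X C (numLevels α cα ε)⌉₊ 1

/-- The MLMC estimator `∑_{ℓ ≤ L(ε)} ∑_{i ≤ M_ℓ(ε)} D ℓ i / M_ℓ(ε)`. -/
def estimator (P : Measure Ω) (X : ℕ → Ω → ℝ) (C : ℕ → ℝ) (α cα : ℝ) (D : ℕ → ℕ → Ω → ℝ)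
    (ε : ℝ) (ω : Ω) : ℝ :=
  ∑ ℓ ∈ Finset.range (numLevels α cα ε + 1),
    ∑ i ∈ Finset.range (numSamples P X C α cα ε ℓ), D ℓ i ω / numSamples P X C α cα ε ℓ

/-- The normalized MLMC estimator. -/
def normalizedEstimator (P : Measure Ω) (X : ℕ → Ω → ℝ) (C : ℕ → ℝ) (α cα : ℝ)
    (D : ℕ → ℕ → Ω → ℝ) (ε : ℝ) (ω : Ω) : ℝ :=
  (estimator P X C α cα D ε ω - ∫ ω', X (numLevels α cα ε) ω' ∂P) /
    Real.sqrt (variance (estimator P X C α cα D ε) P)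

/-- The index set `{(ℓ, i) : ℓ ≤ L(ε), i < M_ℓ(ε)}` of the triangular array of the MLMC estimator;
it has `n(ε) = ∑_{ℓ ≤ L(ε)} M_ℓ(ε)` elements. -/
def arrayIndex (P : Measure Ω) (X : ℕ → Ω → ℝ) (C : ℕ → ℝ) (α cα ε : ℝ) :
    Finset ((_ : ℕ) × ℕ) :=
  (Finset.range (numLevels α cα ε + 1)).sigma
    (fun ℓ => Finset.range (numSamples P X C α cα ε ℓ))

/-- The triangular array of the MLMC estimator: the entry of the `i`-th sample on level `ℓ` is
`(D ℓ i - E[Δ_ℓ X]) / (√Var(estimator) M_ℓ(ε))`. -/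
def array (P : Measure Ω) (X : ℕ → Ω → ℝ) (C : ℕ → ℝ) (α cα : ℝ) (D : ℕ → ℕ → Ω → ℝ)
    (ε : ℝ) (p : (_ : ℕ) × ℕ) (ω : Ω) : ℝ :=
  (D p.1 p.2 ω - ∫ ω', levelDiff X p.1 ω' ∂P) /
    (Real.sqrt (variance (estimator P X C α cα D ε) P) * numSamples P X C α cα ε p.1)

/-- The extended CLT condition for a generalized triangular array `Y ε m`, `m ∈ s ε`: the row sums
converge in distribution to `N(0,1)` as `ε ↓ 0`, and the largest second moment in a row tends
to `0`. (The supremum is over a finite set, hence a maximum when `s ε` is nonempty.) -/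
structure ExtendedCLT {ι : Type*} (P : Measure Ω) [IsProbabilityMeasure P]
    (s : ℝ → Finset ι) (Y : ℝ → ι → Ω → ℝ) : Prop where
  clt : TendstoInDistribution (fun (ε : ℝ) (ω : Ω) => ∑ m ∈ s ε, Y ε m ω) (𝓝[>] 0)
    (id : ℝ → ℝ) (fun _ => P) (gaussianReal 0 1)
  max_tendsto : Tendsto (fun ε : ℝ => ⨆ m : s ε, ∫ ω, (Y ε m ω) ^ 2 ∂P) (𝓝[>] 0) (𝓝 0)

/-- `1_{V_ℓ > 0} E[ |Δ_ℓ X - E Δ_ℓ X|² / V_ℓ ; |Δ_ℓ X - E Δ_ℓ X|² / V_ℓ > t ]`. -/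
def tailExpectation (P : Measure Ω) (X : ℕ → Ω → ℝ) (ℓ : ℕ) (t : ℝ) : ℝ :=
  if 0 < levelVar P X ℓ then
    ∫ ω, Set.indicator
      {ω | t < |levelDiff X ℓ ω - ∫ ω', levelDiff X ℓ ω' ∂P| ^ 2 / levelVar P X ℓ}
      (fun ω => |levelDiff X ℓ ω - ∫ ω', levelDiff X ℓ ω' ∂P| ^ 2 / levelVar P X ℓ) ω ∂P
  else 0

end

end MLMC

/-! ### Lindeberg's theorem by characteristic functions. -/

namespace MLMC

/-! The array entries are independent and centred, and each row has total variance exactly 1, so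
asymptotic normality reduces to the Lindeberg condition. This rests on Lindeberg's theorem
(`tendstoInDistribution_sum_of_lindeberg`) and on a lower bound for the variance of the estimator.

Without rounding in M_ℓ, that variance would be ε². Rounding up loses at most a constant times ε² ·
ε² e^{γL} / S_L². Since ε is at most a constant times e^{-αL}, the loss relative to ε² is controlled
by e^{(γ-2α)L} / S_L², which tends to 0 by the variance decay assumption
(`tendsto_exp_div_levelSum_sq`). Hence the variance is eventually at least ε²/2
(`eventually_le_variance_estimator`). With M_ℓ ≥ ε⁻² √(V_ℓ/C_ℓ) S_L, each second moment is at most 2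
ε² C_ℓ / S_L², and this gives the maximum condition.

The Lindeberg sum is an average of tail expectations over the levels, with weights V_ℓ / (M_ℓ Var),
at thresholds of at least κ e^{2αL-γℓ} S_L² (`exists_threshold_ge`). For ℓ ≤ L this dominates κ
e^{(2α-γ)ℓ} S_ℓ², so the tail hypothesis handles all fine levels uniformly. On each of the finitely
many coarse levels the threshold tends to infinity, and integrability suffices. -/

lemma norm_cexp_mul_I_sub_taylor_two_le_of_abs_le_one {x : ℝ} (hx : |x| ≤ 1) :
    ‖Complex.exp (x * Complex.I) - (1 + x * Complex.I - x ^ 2 / 2)‖ ≤ |x| ^ 3 := by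
  have hn : ‖(x : ℂ) * Complex.I‖ = |x| := by simp
  have h := Complex.exp_bound (x := x * Complex.I) (by rw [hn]; exact hx) (n := 3) (by norm_num)
  rw [hn] at h
  have e : ∑ m ∈ Finset.range 3, ((x : ℂ) * Complex.I) ^ m / (m.factorial : ℂ)
      = 1 + x * Complex.I - x ^ 2 / 2 := by
    simp [Finset.sum_range_succ, mul_pow, Nat.factorial]
    ring
  rw [e] at h
  refine h.trans ?_
  have h0 : 0 ≤ |x| ^ 3 := by positivity
  norm_num [Nat.factorial]
  nlinarith

lemma norm_cexp_mul_I_sub_taylor_two_le_sq (x : ℝ) :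
    ‖Complex.exp (x * Complex.I) - (1 + x * Complex.I - x ^ 2 / 2)‖ ≤ 4 * x ^ 2 := by
  rcases le_or_gt |x| 1 with hx | hx
  · refine (norm_cexp_mul_I_sub_taylor_two_le_of_abs_le_one hx).trans ?_
    rw [← sq_abs x]
    have h0 : 0 ≤ |x| := abs_nonneg x
    nlinarith [mul_nonneg (sq_nonneg |x|) (sub_nonneg.2 hx), sq_nonneg |x|]
  · have h1 : ‖Complex.exp (x * Complex.I)‖ = 1 := Complex.norm_exp_ofReal_mul_I x
    have h2 : ‖(1 : ℂ) + x * Complex.I - x ^ 2 / 2‖ ≤ 1 + |x| + |x| ^ 2 / 2 := by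
      refine (norm_sub_le _ _).trans ?_
      refine add_le_add ((norm_add_le _ _).trans ?_) ?_ <;> simp
    refine (norm_sub_le _ _).trans ?_
    rw [h1, ← sq_abs x]
    nlinarith

/-- The second-order Taylor remainder of `exp (i t y)`, split at the truncation level `η`. -/
lemma norm_cexp_sub_taylor_two_le_truncated (t y : ℝ) {η : ℝ} (hη : 0 ≤ η) (htη : |t| * η ≤ 1) :
    ‖Complex.exp (((t * y : ℝ) : ℂ) * Complex.I)
        - (1 + ((t * y : ℝ) : ℂ) * Complex.I - ((t * y : ℝ) : ℂ) ^ 2 / 2)‖ ≤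
      |t| ^ 3 * η * y ^ 2 + 4 * t ^ 2 * Set.indicator {z : ℝ | η < |z|} (fun z => z ^ 2) y := by
  by_cases hy : η < |y|
  · rw [Set.indicator_of_mem (by exact hy)]
    have := norm_cexp_mul_I_sub_taylor_two_le_sq (t * y)
    have : 0 ≤ |t| ^ 3 * η * y ^ 2 := by positivity
    nlinarith
  · rw [Set.indicator_of_notMem (by exact hy), mul_zero, add_zero]
    have hy' : |y| ≤ η := not_lt.1 hy
    have h1 : |t * y| ≤ 1 := by
      rw [abs_mul]
      exact (mul_le_mul_of_nonneg_left hy' (abs_nonneg t)).trans htη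
    refine (norm_cexp_mul_I_sub_taylor_two_le_of_abs_le_one h1).trans ?_
    calc |t * y| ^ 3 = |t| ^ 3 * |y| * |y| ^ 2 := by rw [abs_mul]; ring
      _ ≤ |t| ^ 3 * η * |y| ^ 2 := by gcongr
      _ = _ := by rw [sq_abs]

/-- Factors are exchanged one at a time; the remaining factors, of modulus at most 1, do not amplify
the error. -/
lemma norm_prod_sub_prod_le {ι : Type*} (s : Finset ι) (a b : ι → ℂ)
    (ha : ∀ i ∈ s, ‖a i‖ ≤ 1) (hb : ∀ i ∈ s, ‖b i‖ ≤ 1) :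
    ‖∏ i ∈ s, a i - ∏ i ∈ s, b i‖ ≤ ∑ i ∈ s, ‖a i - b i‖ := by
  classical
  induction s using Finset.induction_on with
  | empty => simp
  | insert j s hj ih =>
    rw [Finset.prod_insert hj, Finset.prod_insert hj, Finset.sum_insert hj]
    have h1 := ih (fun i hi => ha i (Finset.mem_insert_of_mem hi))
      (fun i hi => hb i (Finset.mem_insert_of_mem hi))
    have h2 : ‖∏ i ∈ s, a i‖ ≤ 1 := by
      rw [norm_prod]
      exact Finset.prod_le_one (fun i _ => norm_nonneg _)
        (fun i hi => ha i (Finset.mem_insert_of_mem hi))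
    have h3 := hb j (Finset.mem_insert_self j s)
    calc ‖a j * ∏ i ∈ s, a i - b j * ∏ i ∈ s, b i‖
        = ‖(a j - b j) * ∏ i ∈ s, a i + b j * (∏ i ∈ s, a i - ∏ i ∈ s, b i)‖ := by
          congr 1; ring
      _ ≤ ‖a j - b j‖ * ‖∏ i ∈ s, a i‖ + ‖b j‖ * ‖∏ i ∈ s, a i - ∏ i ∈ s, b i‖ := by
          rw [← norm_mul, ← norm_mul]; exact norm_add_le _ _
      _ ≤ ‖a j - b j‖ * 1 + 1 * ∑ i ∈ s, ‖a i - b i‖ := by gcongr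
      _ = _ := by ring

lemma abs_exp_neg_sub_one_sub_le {u : ℝ} (hu : 0 ≤ u) : |Real.exp (-u) - (1 - u)| ≤ u ^ 2 := by
  rw [abs_le]
  constructor
  · have := Real.add_one_le_exp (-u)
    nlinarith [sq_nonneg u]
  · have h1 : Real.exp (-u) ≤ 1 / (1 + u) := by
      rw [Real.exp_neg, ← one_div]
      apply one_div_le_one_div_of_le (by linarith)
      linarith [Real.add_one_le_exp u]
    have h2 : 1 / (1 + u) ≤ 1 - u + u ^ 2 := by
      rw [div_le_iff₀ (by linarith)]
      nlinarith [pow_nonneg hu 3]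
    linarith

variable {Ω : Type*} [MeasurableSpace Ω] {P : Measure Ω}

lemma integrable_indicator_sq {Y : Ω → ℝ} (hY : MemLp Y 2 P) (η : ℝ) :
    Integrable (fun ω => Set.indicator {z : ℝ | η < |z|} (fun z => z ^ 2) (Y ω)) P := by
  refine hY.integrable_sq.mono' ?_ (ae_of_all _ fun ω => ?_)
  · refine (Measurable.comp_aemeasurable (Measurable.indicator (by fun_prop) ?_)
      hY.aestronglyMeasurable.aemeasurable).aestronglyMeasurable
    exact measurableSet_lt measurable_const (by fun_prop)
  · by_cases h : η < |Y ω| <;> simp [h, sq_nonneg]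

variable [IsProbabilityMeasure P]

/-- Centring kills the linear Taylor term, so only the truncated second-order remainder is left to
integrate. -/
lemma norm_charFun_sub_le {Y : Ω → ℝ} (hY : MemLp Y 2 P) (h0 : ∫ ω, Y ω ∂P = 0) (t : ℝ) {η : ℝ}
    (hη : 0 ≤ η) (htη : |t| * η ≤ 1) :
    ‖charFun (P.map Y) t - ((1 - t ^ 2 * (∫ ω, Y ω ^ 2 ∂P) / 2 : ℝ) : ℂ)‖ ≤
      |t| ^ 3 * η * (∫ ω, Y ω ^ 2 ∂P)
        + 4 * t ^ 2 * ∫ ω, Set.indicator {z : ℝ | η < |z|} (fun z => z ^ 2) (Y ω) ∂P := by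
  have hint : Integrable Y P := hY.integrable (by norm_num)
  have hsq : Integrable (fun ω => Y ω ^ 2) P := hY.integrable_sq
  have hm : AEMeasurable Y P := hY.aestronglyMeasurable.aemeasurable
  have hind := integrable_indicator_sq hY η
  have hexp : Integrable (fun ω => Complex.exp (((t * Y ω : ℝ) : ℂ) * Complex.I)) P := by
    refine (integrable_const (1 : ℝ)).mono' ?_ (ae_of_all _ fun ω => ?_)
    · exact AEMeasurable.aestronglyMeasurable (by fun_prop)
    · rw [Complex.norm_exp_ofReal_mul_I]
  have hlin : Integrable (fun ω => ((t * Y ω : ℝ) : ℂ) * Complex.I) P :=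
    (hint.const_mul t).ofReal.mul_const _
  have hquad : Integrable (fun ω => ((t * Y ω : ℝ) : ℂ) ^ 2 / 2) P := by
    have := ((hsq.const_mul (t ^ 2)).ofReal (𝕜 := ℂ)).div_const 2
    refine this.congr (ae_of_all _ fun ω => ?_)
    simp; ring
  have hone : Integrable (fun _ : Ω => (1 : ℂ)) P := integrable_const _
  have hadd : Integrable (fun ω => 1 + ((t * Y ω : ℝ) : ℂ) * Complex.I) P := hone.add hlin
  have hpoly : Integrable
      (fun ω => 1 + ((t * Y ω : ℝ) : ℂ) * Complex.I - ((t * Y ω : ℝ) : ℂ) ^ 2 / 2) P :=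
    hadd.sub hquad
  have e1 : charFun (P.map Y) t = ∫ ω, Complex.exp (((t * Y ω : ℝ) : ℂ) * Complex.I) ∂P := by
    rw [charFun_apply_real, integral_map hm (by fun_prop)]
    simp
  have e2 : ((1 - t ^ 2 * (∫ ω, Y ω ^ 2 ∂P) / 2 : ℝ) : ℂ)
      = ∫ ω, (1 + ((t * Y ω : ℝ) : ℂ) * Complex.I - ((t * Y ω : ℝ) : ℂ) ^ 2 / 2) ∂P := by
    have l1 : ∫ ω, ((t * Y ω : ℝ) : ℂ) * Complex.I ∂P = 0 := by
      rw [integral_mul_const, integral_complex_ofReal, integral_const_mul, h0]; simp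
    have l2 : ∫ ω, ((t * Y ω : ℝ) : ℂ) ^ 2 / 2 ∂P = ((t ^ 2 * (∫ ω, Y ω ^ 2 ∂P) / 2 : ℝ) : ℂ) := by
      rw [← integral_const_mul, ← integral_div, ← integral_complex_ofReal]
      refine integral_congr_ae (ae_of_all _ fun ω => ?_)
      simp; ring
    rw [integral_sub hadd hquad, integral_add hone hlin, l1, l2]
    simp
  rw [e1, e2, ← integral_sub hexp hpoly, ← integral_const_mul, ← integral_const_mul,
    ← integral_add (hsq.const_mul _) (hind.const_mul _)]
  refine norm_integral_le_of_norm_le ((hsq.const_mul _).add (hind.const_mul _))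
    (ae_of_all _ fun ω => ?_)
  exact norm_cexp_sub_taylor_two_le_truncated t (Y ω) hη htη

/-- The characteristic function of a sum of independent centred variables of total variance `1`
differs from the standard Gaussian one by at most a Lindeberg-type error. -/
lemma norm_charFun_sum_sub_le {ι : Type*} (s : Finset ι) {Y : ι → Ω → ℝ}
    (hY : ∀ i, MemLp (Y i) 2 P) (h0 : ∀ i, ∫ ω, Y i ω ∂P = 0) (hind : iIndepFun Y P)
    (hone : ∑ i ∈ s, ∫ ω, Y i ω ^ 2 ∂P = 1) (t : ℝ) {η : ℝ} (hη : 0 ≤ η) (htη : |t| * η ≤ 1) :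
    ‖charFun (P.map (fun ω => ∑ i ∈ s, Y i ω)) t - ((Real.exp (-(t ^ 2 / 2)) : ℝ) : ℂ)‖ ≤
      |t| ^ 3 * η + t ^ 4 * η ^ 2 + (4 * t ^ 2 + t ^ 4) *
        ∑ i ∈ s, ∫ ω, Set.indicator {z : ℝ | η < |z|} (fun z => z ^ 2) (Y i ω) ∂P := by
  set Λ : ι → ℝ := fun i => ∫ ω, Set.indicator {z : ℝ | η < |z|} (fun z => z ^ 2) (Y i ω) ∂P with hΛ
  set σ : ι → ℝ := fun i => ∫ ω, Y i ω ^ 2 ∂P with hσ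
  have hm i : AEMeasurable (Y i) P := (hY i).aestronglyMeasurable.aemeasurable
  have hσ0 i : 0 ≤ σ i := integral_nonneg fun ω => sq_nonneg _
  have hΛ0 i : 0 ≤ Λ i := integral_nonneg fun ω => Set.indicator_nonneg (fun z _ => sq_nonneg z) _
  -- Lindeberg's quantity bounds every single variance, so no separate negligibility assumption is
  -- needed to absorb the terms quadratic in `σ i`.
  have hσΛ i (hi : i ∈ s) : σ i ≤ η ^ 2 + ∑ j ∈ s, Λ j := by
    have hint := integrable_indicator_sq (hY i) η
    have h1 : σ i ≤ ∫ ω, (η ^ 2 + Set.indicator {z : ℝ | η < |z|} (fun z => z ^ 2) (Y i ω)) ∂P := by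
      refine integral_mono (hY i).integrable_sq ((integrable_const _).add hint) fun ω => ?_
      by_cases h : η < |Y i ω|
      · simp [h, sq_nonneg]
      · simp only [Set.mem_ofPred_eq, h, not_false_eq_true, Set.indicator_of_notMem, add_zero]
        rw [← sq_abs (Y i ω)]
        exact pow_le_pow_left₀ (abs_nonneg _) (not_lt.1 h) 2
    rw [integral_add (integrable_const _) hint] at h1
    have h2 : Λ i ≤ ∑ j ∈ s, Λ j := Finset.single_le_sum (fun j _ => hΛ0 j) hi
    simp at h1
    linarith
  have e1 : charFun (P.map (fun ω => ∑ i ∈ s, Y i ω)) t = ∏ i ∈ s, charFun (P.map (Y i)) t := by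
    rw [(hind.restrict _).charFun_map_fun_finsetSum_eq_prod (fun i _ => hm i)]
    simp
  -- As the variances add up to 1, the Gaussian splits into factors matched to the individual
  -- summands.
  have e2 : ((Real.exp (-(t ^ 2 / 2)) : ℝ) : ℂ)
      = ∏ i ∈ s, ((Real.exp (-(t ^ 2 * σ i / 2)) : ℝ) : ℂ) := by
    rw [← Complex.ofReal_prod, ← Real.exp_sum]
    congr 2
    rw [Finset.sum_neg_distrib, ← Finset.sum_div, ← Finset.mul_sum, hone, mul_one]
  have hterm i (hi : i ∈ s) :
      ‖charFun (P.map (Y i)) t - ((Real.exp (-(t ^ 2 * σ i / 2)) : ℝ) : ℂ)‖ ≤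
        (|t| ^ 3 * η * σ i + 4 * t ^ 2 * Λ i)
          + t ^ 4 * (η ^ 2 + ∑ j ∈ s, Λ j) * σ i := by
    have a1 := norm_charFun_sub_le (hY i) (h0 i) t hη htη
    have a2 := abs_exp_neg_sub_one_sub_le (u := t ^ 2 * σ i / 2) (by have := hσ0 i; positivity)
    have a3 : ‖((1 - t ^ 2 * σ i / 2 : ℝ) : ℂ) - ((Real.exp (-(t ^ 2 * σ i / 2)) : ℝ) : ℂ)‖ ≤
        (t ^ 2 * σ i / 2) ^ 2 := by
      rw [← Complex.ofReal_sub, Complex.norm_real, Real.norm_eq_abs, abs_sub_comm]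
      exact a2
    have a4 : (t ^ 2 * σ i / 2) ^ 2 ≤ t ^ 4 * (η ^ 2 + ∑ j ∈ s, Λ j) * σ i := by
      have : (t ^ 2 * σ i / 2) ^ 2 = t ^ 4 * σ i * σ i / 4 := by ring
      rw [this]
      have h3 : t ^ 4 * σ i * σ i ≤ t ^ 4 * (η ^ 2 + ∑ j ∈ s, Λ j) * σ i := by
        have := hσ0 i
        gcongr
        exact hσΛ i hi
      have : 0 ≤ t ^ 4 * σ i * σ i := by
        have := hσ0 i
        positivity
      linarith
    calc _ = ‖(charFun (P.map (Y i)) t - ((1 - t ^ 2 * σ i / 2 : ℝ) : ℂ)) +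
          (((1 - t ^ 2 * σ i / 2 : ℝ) : ℂ) - ((Real.exp (-(t ^ 2 * σ i / 2)) : ℝ) : ℂ))‖ := by
            congr 1; ring
      _ ≤ _ := (norm_add_le _ _).trans (add_le_add a1 (a3.trans a4))
  rw [e1, e2]
  refine (norm_prod_sub_prod_le s _ _ (fun i _ => ?_) (fun i _ => ?_)).trans
    ((Finset.sum_le_sum hterm).trans ?_)
  · have := Measure.isProbabilityMeasure_map (hm i)
    exact norm_charFun_le_one _
  · rw [Complex.norm_real, Real.norm_eq_abs, abs_of_pos (Real.exp_pos _), Real.exp_le_one_iff]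
    have := hσ0 i
    have : 0 ≤ t ^ 2 * σ i / 2 := by positivity
    linarith
  · rw [Finset.sum_add_distrib, Finset.sum_add_distrib, ← Finset.mul_sum, ← Finset.mul_sum,
      ← Finset.mul_sum, hone]
    apply le_of_eq
    ring

/-- **Lindeberg's central limit theorem** for triangular arrays along a countably generated
filter. -/
theorem tendstoInDistribution_sum_of_lindeberg {κ ι : Type*} {l : Filter κ}
    [l.IsCountablyGenerated] (s : κ → Finset ι) {Y : κ → ι → Ω → ℝ}
    (hY : ∀ k i, MemLp (Y k i) 2 P) (h0 : ∀ k i, ∫ ω, Y k i ω ∂P = 0)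
    (hind : ∀ k, iIndepFun (Y k) P)
    (hone : ∀ᶠ k in l, ∑ i ∈ s k, ∫ ω, Y k i ω ^ 2 ∂P = 1)
    (hlin : ∀ η : ℝ, 0 < η → Tendsto (fun k => ∑ i ∈ s k,
      ∫ ω, Set.indicator {z : ℝ | η < |z|} (fun z => z ^ 2) (Y k i ω) ∂P) l (𝓝 0)) :
    TendstoInDistribution (fun k ω => ∑ i ∈ s k, Y k i ω) l (id : ℝ → ℝ) (fun _ => P)
      (gaussianReal 0 1) := by
  have hm k : AEMeasurable (fun ω => ∑ i ∈ s k, Y k i ω) P :=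
    Finset.aemeasurable_fun_sum _ fun i _ => (hY k i).aestronglyMeasurable.aemeasurable
  have key (t : ℝ) : Tendsto (fun k => charFun (P.map (fun ω => ∑ i ∈ s k, Y k i ω)) t) l
      (𝓝 ((Real.exp (-(t ^ 2 / 2)) : ℝ) : ℂ)) := by
    rw [tendsto_iff_norm_sub_tendsto_zero]
    refine (nhds_basis_abs_sub_lt (0 : ℝ)).tendsto_right_iff.2 fun δ hδ => ?_
    -- The truncation level depends on t and δ only and is fixed before k moves.
    obtain ⟨η, hη, htη, hsmall⟩ : ∃ η : ℝ, 0 < η ∧ |t| * η ≤ 1 ∧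
        |t| ^ 3 * η + t ^ 4 * η ^ 2 < δ / 2 := by
      have c1 : Tendsto (fun η : ℝ => |t| * η) (𝓝[>] 0) (𝓝 0) := by
        refine (Continuous.tendsto' (by fun_prop) 0 0 (by simp)).mono_left nhdsWithin_le_nhds
      have c2 : Tendsto (fun η : ℝ => |t| ^ 3 * η + t ^ 4 * η ^ 2) (𝓝[>] 0) (𝓝 0) := by
        refine (Continuous.tendsto' (by fun_prop) 0 0 (by simp)).mono_left nhdsWithin_le_nhds
      obtain ⟨η, hη⟩ := ((eventually_mem_nhdsWithin (a := (0 : ℝ)) (s := Set.Ioi 0)).and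
        ((c1.eventually_le_const one_pos).and (c2.eventually_lt_const (half_pos hδ)))).exists
      exact ⟨η, hη.1, hη.2.1, hη.2.2⟩
    have h2 : Tendsto (fun k => (4 * t ^ 2 + t ^ 4) * ∑ i ∈ s k,
        ∫ ω, Set.indicator {z : ℝ | η < |z|} (fun z => z ^ 2) (Y k i ω) ∂P) l (𝓝 0) := by
      simpa using (hlin η hη).const_mul (4 * t ^ 2 + t ^ 4)
    filter_upwards [hone, h2.eventually_lt_const (half_pos hδ)] with k hk1 hk2
    rw [sub_zero, abs_of_nonneg (norm_nonneg _)]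
    have := norm_charFun_sum_sub_le (s k) (hY k) (h0 k) (hind k) hk1 t hη.le htη
    linarith
  refine ⟨hm, by fun_prop, ?_⟩
  -- Lévy's continuity theorem is applied along sequences, which suffice because `l` is countably
  -- generated.
  refine tendsto_of_seq_tendsto fun u hu => ?_
  refine ProbabilityMeasure.tendsto_iff_tendsto_charFun.2 fun t => ?_
  convert! (key t).comp hu using 2
  simp [charFun_gaussianReal]

end MLMC

/-! ### Asymptotics of the number of levels and of the level sums. -/

namespace MLMC

section NumLevels

variable {α cα : ℝ}

/-- The ceiling and the maximum with 1 raise L by at most one above log(cα/ε)/α, which costs the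
factor e^α. The condition ε ≤ cα makes the logarithm nonnegative. -/
lemma le_mul_exp_neg_numLevels (hα : 0 < α) (hc : 0 < cα) {ε : ℝ} (hε : 0 < ε) (hεc : ε ≤ cα) :
    ε ≤ cα * Real.exp α * Real.exp (-(α * numLevels α cα ε)) := by
  have h1 : 1 ≤ cα * ε⁻¹ := by
    rw [← div_eq_mul_inv]; exact (one_le_div hε).2 hεc
  have hlog : 0 ≤ Real.log (cα * ε⁻¹) := Real.log_nonneg h1
  have hL : (numLevels α cα ε : ℝ) ≤ Real.log (cα * ε⁻¹) / α + 1 := by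
    have hx : 0 ≤ Real.log (cα * ε⁻¹) / α := div_nonneg hlog hα.le
    unfold numLevels
    rw [Nat.cast_max]
    refine max_le (Nat.ceil_lt_add_one hx).le ?_
    simpa using hx
  have h2 : α * numLevels α cα ε ≤ Real.log (cα * ε⁻¹) + α := by
    calc α * numLevels α cα ε ≤ α * (Real.log (cα * ε⁻¹) / α + 1) := by gcongr
      _ = _ := by field_simp
  have h3 : Real.exp (α * numLevels α cα ε) ≤ cα * ε⁻¹ * Real.exp α := by
    calc _ ≤ Real.exp (Real.log (cα * ε⁻¹) + α) := Real.exp_le_exp.2 h2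
      _ = _ := by rw [Real.exp_add, Real.exp_log (by linarith)]
  rw [Real.exp_neg, ← div_eq_mul_inv, le_div_iff₀ (Real.exp_pos _)]
  calc ε * Real.exp (α * numLevels α cα ε) ≤ ε * (cα * ε⁻¹ * Real.exp α) := by gcongr
    _ = _ := by field_simp

lemma tendsto_numLevels (hα : 0 < α) (hc : 0 < cα) :
    Tendsto (numLevels α cα) (𝓝[>] 0) atTop := by
  have h : Tendsto (fun ε : ℝ => Real.log (cα * ε⁻¹) / α) (𝓝[>] 0) atTop :=
    (Real.tendsto_log_atTop.comp (tendsto_inv_nhdsGT_zero.const_mul_atTop hc)).atTop_div_const hα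
  exact tendsto_atTop_mono (fun ε => le_max_left _ _) (tendsto_nat_ceil_atTop.comp h)

end NumLevels

variable {Ω : Type*} [MeasurableSpace Ω] {P : Measure Ω}
  {Xlim : Ω → ℝ} {X : ℕ → Ω → ℝ} {C : ℕ → ℝ} {α β γ cα : ℝ}

lemma levelVar_nonneg (ℓ : ℕ) : 0 ≤ levelVar P X ℓ := variance_nonneg _ _

lemma RateAssumption.cost_pos (h : RateAssumption P Xlim X C α β γ cα) (ℓ : ℕ) : 0 < C ℓ := by
  obtain ⟨k, K, hk, _, hC⟩ := h.cost_rate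
  have h1 : 0 ≤ k * |Real.exp (γ * ℓ)| := by positivity
  have h2 := h1.trans_lt (hC ℓ).1
  exact lt_of_le_of_ne (h.cost_nonneg ℓ) (Ne.symm (abs_pos.1 h2))

lemma RateAssumption.exists_cost_le (h : RateAssumption P Xlim X C α β γ cα) :
    ∃ K : ℝ, 0 < K ∧ ∀ ℓ : ℕ, C ℓ ≤ K * Real.exp (γ * ℓ) := by
  obtain ⟨k, K, hk, hkK, hC⟩ := h.cost_rate
  refine ⟨K, hk.trans hkK, fun ℓ => ?_⟩
  have h1 := (hC ℓ).2.le
  rw [abs_of_pos (Real.exp_pos _)] at h1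
  exact (le_abs_self _).trans h1

lemma sum_exp_mul_le (hγ : 0 < γ) (n : ℕ) :
    ∑ ℓ ∈ Finset.range (n + 1), Real.exp (γ * ℓ) ≤
      (1 - Real.exp (-γ))⁻¹ * Real.exp (γ * n) := by
  have hq : 0 < 1 - Real.exp (-γ) := by
    have : Real.exp (-γ) < 1 := by simpa using hγ
    linarith
  induction n with
  | zero =>
    simp only [zero_add, Finset.range_one, Finset.sum_singleton, CharP.cast_eq_zero, mul_zero,
      Real.exp_zero, mul_one]
    exact (one_le_inv₀ hq).2 (by linarith [Real.exp_pos (-γ)])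
  | succ n ih =>
    rw [Finset.sum_range_succ]
    have e : Real.exp (γ * n) = Real.exp (-γ) * Real.exp (γ * (n + 1 : ℕ)) := by
      rw [← Real.exp_add]; push_cast; ring_nf
    rw [e] at ih
    have e2 : (1 - Real.exp (-γ))⁻¹ * Real.exp (γ * (n + 1 : ℕ)) =
        (1 - Real.exp (-γ))⁻¹ * (Real.exp (-γ) * Real.exp (γ * (n + 1 : ℕ)))
          + Real.exp (γ * (n + 1 : ℕ)) := by
      field_simp
      ring
    linarith

lemma levelSum_mono : Monotone (levelSum P X C) := by
  refine monotone_nat_of_le_succ fun k => ?_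
  unfold levelSum
  rw [Finset.sum_range_succ _ (k + 1)]
  exact le_add_of_nonneg_right (Real.sqrt_nonneg _)

lemma levelSum_zero_pos (h : RateAssumption P Xlim X C α β γ cα)
    (hv : VarianceDecayAssumption P X C α β γ) : 0 < levelSum P X C 0 := by
  simp only [levelSum, zero_add, Finset.range_one, Finset.sum_singleton]
  exact Real.sqrt_pos.2 (mul_pos hv.var_zero_pos (h.cost_pos 0))

lemma levelSum_pos (h : RateAssumption P Xlim X C α β γ cα)
    (hv : VarianceDecayAssumption P X C α β γ) (k : ℕ) : 0 < levelSum P X C k :=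
  (levelSum_zero_pos h hv).trans_le (levelSum_mono (Nat.zero_le k))

/-- If β = γ, then γ ≤ 2α bounds the numerator while S_k diverges. If β < γ, eventually S_k² ≥
e^{(γ-υ)k}, so the quotient is at most e^{(υ-2α)k} with υ < 2α. -/
lemma tendsto_exp_div_levelSum_sq (h : RateAssumption P Xlim X C α β γ cα) (hβγ : β ≤ γ)
    (hv : VarianceDecayAssumption P X C α β γ) :
    Tendsto (fun k : ℕ => Real.exp ((γ - 2 * α) * k) / levelSum P X C k ^ 2) atTop (𝓝 0) := by
  have hS := levelSum_pos h hv
  rcases hβγ.eq_or_lt with heq | hlt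
  · have hγα : γ ≤ 2 * α := by simpa [heq] using h.min_le
    have h1 : Tendsto (fun k : ℕ => (levelSum P X C k ^ 2)⁻¹) atTop (𝓝 0) :=
      tendsto_inv_atTop_zero.comp
        ((tendsto_pow_atTop (two_ne_zero)).comp (hv.of_eq heq))
    refine squeeze_zero (fun k => by positivity) (fun k => ?_) h1
    rw [div_eq_mul_inv]
    refine mul_le_of_le_one_left (by positivity) (Real.exp_le_one_iff.2 ?_)
    exact mul_nonpos_of_nonpos_of_nonneg (by linarith) (Nat.cast_nonneg k)
  · obtain ⟨_, υ, _, hυ, hlim⟩ := hv.of_lt hlt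
    have h1 := eventually_lt_of_lt_liminf hlim
    have h2 : Tendsto (fun k : ℕ => Real.exp ((υ - 2 * α) * k)) atTop (𝓝 0) :=
      Real.tendsto_exp_atBot.comp
        (tendsto_natCast_atTop_atTop.const_mul_atTop_of_neg (by linarith))
    refine squeeze_zero' (Eventually.of_forall fun k => by positivity) ?_ h2
    filter_upwards [h1] with k hk
    have hk' : (1 : ℝ) < levelSum P X C k * Real.exp ((υ - γ) * k / 2) := by exact_mod_cast hk
    have h3 : 1 ≤ levelSum P X C k ^ 2 * Real.exp ((υ - γ) * k) := by
      have : (levelSum P X C k * Real.exp ((υ - γ) * k / 2)) ^ 2 =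
          levelSum P X C k ^ 2 * Real.exp ((υ - γ) * k) := by
        rw [mul_pow, ← Real.exp_nat_mul]; congr 2; push_cast; ring
      rw [← this]
      exact one_le_pow₀ hk'.le
    have hSk := hS k
    rw [div_le_iff₀ (by positivity)]
    calc Real.exp ((γ - 2 * α) * k)
        ≤ Real.exp ((γ - 2 * α) * k) * (levelSum P X C k ^ 2 * Real.exp ((υ - γ) * k)) :=
          le_mul_of_one_le_right (Real.exp_pos _).le h3
      _ = (Real.exp ((γ - 2 * α) * k) * Real.exp ((υ - γ) * k)) * levelSum P X C k ^ 2 := by ring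
      _ = _ := by rw [← Real.exp_add]; ring_nf

/-- `ε² e^{γ L(ε)} / S_{L(ε)}² → 0` as `ε ↓ 0`. -/
lemma tendsto_sq_mul_exp_div_levelSum_sq (h : RateAssumption P Xlim X C α β γ cα) (hβγ : β ≤ γ)
    (hv : VarianceDecayAssumption P X C α β γ) :
    Tendsto (fun ε : ℝ => ε ^ 2 * Real.exp (γ * numLevels α cα ε)
      / levelSum P X C (numLevels α cα ε) ^ 2) (𝓝[>] 0) (𝓝 0) := by
  have h1 := ((tendsto_exp_div_levelSum_sq h hβγ hv).comp
    (tendsto_numLevels h.alpha_pos h.calpha_pos)).const_mul ((cα * Real.exp α) ^ 2)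
  rw [mul_zero] at h1
  refine squeeze_zero' (Eventually.of_forall fun ε => by positivity) ?_ h1
  filter_upwards [Ioc_mem_nhdsGT h.calpha_pos] with ε hε
  have h2 := le_mul_exp_neg_numLevels h.alpha_pos h.calpha_pos hε.1 hε.2
  have hS := levelSum_pos h hv (numLevels α cα ε)
  set L := numLevels α cα ε with hL
  have h3 : ε ^ 2 ≤ (cα * Real.exp α) ^ 2 * Real.exp (-(2 * α * L)) := by
    calc ε ^ 2 ≤ (cα * Real.exp α * Real.exp (-(α * L))) ^ 2 := pow_le_pow_left₀ hε.1.le h2 2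
      _ = _ := by rw [mul_pow _ (Real.exp (-(α * L))), ← Real.exp_nat_mul]; congr 2; push_cast; ring
  simp only [Function.comp_apply]
  rw [← hL, ← mul_div_assoc]
  refine div_le_div_of_nonneg_right ?_ (by positivity)
  calc ε ^ 2 * Real.exp (γ * L)
      ≤ (cα * Real.exp α) ^ 2 * Real.exp (-(2 * α * L)) * Real.exp (γ * L) := by gcongr
    _ = _ := by rw [mul_assoc, ← Real.exp_add]; ring_nf

/-! ### Rounding of the sample numbers. -/

section NumSamples

variable (P X C α cα) in
lemma one_le_numSamples (ε : ℝ) (ℓ : ℕ) : 1 ≤ numSamples P X C α cα ε ℓ := le_max_right _ _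

variable (P X C α cα) in
lemma numSamples_cast_pos (ε : ℝ) (ℓ : ℕ) : (0 : ℝ) < numSamples P X C α cα ε ℓ :=
  Nat.cast_pos.2 (one_le_numSamples P X C α cα ε ℓ)

lemma le_numSamples (ε : ℝ) (ℓ : ℕ) :
    (ε ^ 2)⁻¹ * Real.sqrt (levelVar P X ℓ / C ℓ) * levelSum P X C (numLevels α cα ε) ≤
      numSamples P X C α cα ε ℓ := by
  refine (Nat.le_ceil _).trans ?_
  exact_mod_cast le_max_left _ _

lemma levelSum_nonneg (k : ℕ) : 0 ≤ levelSum P X C k :=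
  Finset.sum_nonneg fun _ _ => Real.sqrt_nonneg _

lemma numSamples_le (ε : ℝ) (ℓ : ℕ) :
    (numSamples P X C α cα ε ℓ : ℝ) ≤
      (ε ^ 2)⁻¹ * Real.sqrt (levelVar P X ℓ / C ℓ) * levelSum P X C (numLevels α cα ε) + 1 := by
  have h0 : 0 ≤ (ε ^ 2)⁻¹ * Real.sqrt (levelVar P X ℓ / C ℓ)
      * levelSum P X C (numLevels α cα ε) := by
    have := levelSum_nonneg (P := P) (X := X) (C := C) (numLevels α cα ε)
    positivity
  unfold numSamples
  rw [Nat.cast_max]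
  refine max_le (Nat.ceil_lt_add_one h0).le ?_
  simpa using h0

lemma sq_le_numSamples_sq (h : RateAssumption P Xlim X C α β γ cα) (ε : ℝ) (ℓ : ℕ) :
    levelVar P X ℓ * levelSum P X C (numLevels α cα ε) ^ 2 / (ε ^ 4 * C ℓ) ≤
      (numSamples P X C α cα ε ℓ : ℝ) ^ 2 := by
  have hS := levelSum_nonneg (P := P) (X := X) (C := C) (numLevels α cα ε)
  have hV := levelVar_nonneg (P := P) (X := X) ℓ
  have hC := h.cost_pos ℓ
  have h1 := pow_le_pow_left₀ (by positivity) (le_numSamples (P := P) (X := X) (C := C) (α := α)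
    (cα := cα) ε ℓ) 2
  refine le_trans (le_of_eq ?_) h1
  rw [mul_pow, mul_pow, Real.sq_sqrt (by positivity), inv_pow, ← pow_mul]
  field_simp

/-- The level variances of the estimator are bounded below up to the rounding error. -/
lemma levelVar_div_numSamples_ge (h : RateAssumption P Xlim X C α β γ cα)
    (hv : VarianceDecayAssumption P X C α β γ) {ε : ℝ} (hε : 0 < ε) (ℓ : ℕ) :
    ε ^ 2 * Real.sqrt (levelVar P X ℓ * C ℓ) / levelSum P X C (numLevels α cα ε)
        - ε ^ 4 * C ℓ / levelSum P X C (numLevels α cα ε) ^ 2 ≤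
      levelVar P X ℓ / numSamples P X C α cα ε ℓ := by
  have hS := levelSum_pos h hv (numLevels α cα ε)
  have hC := h.cost_pos ℓ
  have hM := numSamples_cast_pos P X C α cα ε ℓ
  have hMle := numSamples_le (P := P) (X := X) (C := C) (α := α) (cα := cα) ε ℓ
  set S := levelSum P X C (numLevels α cα ε)
  set M : ℝ := ((numSamples P X C α cα ε ℓ : ℕ) : ℝ)
  rcases (levelVar_nonneg (P := P) (X := X) ℓ).eq_or_lt with hV | hV
  · rw [← hV]
    simp only [zero_mul, Real.sqrt_zero, mul_zero, zero_div, zero_sub, neg_nonpos]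
    positivity
  · set V := levelVar P X ℓ
    rw [Real.sqrt_mul hV.le]
    rw [Real.sqrt_div hV.le] at hMle
    have ha := Real.sqrt_pos.2 hV
    have hb := Real.sqrt_pos.2 hC
    have haV := Real.sq_sqrt hV.le
    have hbC := Real.sq_sqrt hC.le
    set a := Real.sqrt V
    set b := Real.sqrt (C ℓ)
    -- With this u the unrounded sample number is a/u, and the claim becomes u(a-u)M ≤ a². For a > u
    -- it follows from M ≤ a/u + 1, since u(a-u)(a/u + 1) = a² - u²; otherwise the left side is
    -- nonpositive.
    obtain ⟨u, hu⟩ : ∃ u, u = ε ^ 2 * b / S := ⟨_, rfl⟩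
    have hu0 : 0 < u := hu ▸ by positivity
    have e1 : ε ^ 2 * (a * b) / S - ε ^ 4 * C ℓ / S ^ 2 = u * (a - u) := by
      rw [hu, ← hbC]; field_simp
    have e2 : (ε ^ 2)⁻¹ * (a / b) * S = a / u := by
      rw [hu]; field_simp
    rw [e2] at hMle
    rw [e1, ← haV, le_div_iff₀ hM]
    rcases le_or_gt a u with hau | hau
    · have : u * (a - u) * M ≤ 0 :=
        mul_nonpos_of_nonpos_of_nonneg
          (mul_nonpos_of_nonneg_of_nonpos hu0.le (by linarith)) hM.le
      nlinarith [sq_nonneg a]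
    · calc u * (a - u) * M ≤ u * (a - u) * (a / u + 1) := by
            have : 0 ≤ u * (a - u) := mul_nonneg hu0.le (by linarith)
            gcongr
        _ = a ^ 2 - u ^ 2 := by field_simp; ring
        _ ≤ a ^ 2 := by linarith [sq_nonneg u]

end NumSamples

end MLMC

/-! ### Variance of the estimator. -/

namespace MLMC

variable {Ω : Type*} [MeasurableSpace Ω] {P : Measure Ω}
  {Xlim : Ω → ℝ} {X : ℕ → Ω → ℝ} {C : ℕ → ℝ} {α β γ cα : ℝ} {D : ℕ → ℕ → Ω → ℝ}

lemma memLp_levelDiff (h : RateAssumption P Xlim X C α β γ cα) (ℓ : ℕ) :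
    MemLp (levelDiff X ℓ) 2 P := by
  cases ℓ with
  | zero => exact h.memLp 0
  | succ ℓ => exact (h.memLp (ℓ + 1)).sub (h.memLp ℓ)

lemma IsSampling.memLp (hD : IsSampling P X D) (h : RateAssumption P Xlim X C α β γ cα)
    (ℓ i : ℕ) : MemLp (D ℓ i) 2 P :=
  (hD.identDistrib ℓ i).memLp_iff.2 (memLp_levelDiff h ℓ)

lemma IsSampling.iIndepFun_sigma (hD : IsSampling P X D) :
    iIndepFun (fun p : (_ : ℕ) × ℕ => D p.1 p.2) P :=
  hD.indep.precomp (g := fun p : (_ : ℕ) × ℕ => (p.1, p.2)) fun p q hpq => by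
    cases p; cases q; simpa using hpq

lemma sum_integral_levelDiff [IsProbabilityMeasure P] (h : RateAssumption P Xlim X C α β γ cα)
    (L : ℕ) : ∑ ℓ ∈ Finset.range (L + 1), ∫ ω, levelDiff X ℓ ω ∂P = ∫ ω, X L ω ∂P := by
  have hint ℓ : Integrable (X ℓ) P := (h.memLp ℓ).integrable (by norm_num)
  induction L with
  | zero => simp [levelDiff]
  | succ L ih =>
    rw [Finset.sum_range_succ, ih]
    simp only [levelDiff]
    rw [integral_sub (hint _) (hint _)]
    ring

lemma estimator_eq_sum_arrayIndex (ε : ℝ) :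
    estimator P X C α cα D ε = ∑ p ∈ arrayIndex P X C α cα ε,
      fun ω => (numSamples P X C α cα ε p.1 : ℝ)⁻¹ * D p.1 p.2 ω := by
  ext ω
  simp only [estimator, arrayIndex, Finset.sum_apply, Finset.sum_sigma, div_eq_inv_mul]

lemma sum_arrayIndex_fst (ε : ℝ) (f : ℕ → ℝ) :
    ∑ p ∈ arrayIndex P X C α cα ε, f p.1 =
      ∑ ℓ ∈ Finset.range (numLevels α cα ε + 1), numSamples P X C α cα ε ℓ * f ℓ := by
  simp [arrayIndex, Finset.sum_sigma]

lemma variance_estimator (h : RateAssumption P Xlim X C α β γ cα) (hD : IsSampling P X D)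
    (ε : ℝ) :
    variance (estimator P X C α cα D ε) P = ∑ ℓ ∈ Finset.range (numLevels α cα ε + 1),
      levelVar P X ℓ / numSamples P X C α cα ε ℓ := by
  rw [estimator_eq_sum_arrayIndex, IndepFun.variance_sum]
  · have e (p : (_ : ℕ) × ℕ) :
        variance (fun ω => (numSamples P X C α cα ε p.1 : ℝ)⁻¹ * D p.1 p.2 ω) P =
          ((numSamples P X C α cα ε p.1 : ℝ)⁻¹) ^ 2 * levelVar P X p.1 := by
      rw [variance_const_mul, (hD.identDistrib p.1 p.2).variance_eq, levelVar]
    simp_rw [e]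
    rw [sum_arrayIndex_fst ε
      (fun ℓ => ((numSamples P X C α cα ε ℓ : ℝ)⁻¹) ^ 2 * levelVar P X ℓ)]
    refine Finset.sum_congr rfl fun ℓ _ => ?_
    have := numSamples_cast_pos P X C α cα ε ℓ
    field_simp
  · exact fun p _ => (hD.memLp h p.1 p.2).const_mul _
  · intro p _ q _ hpq
    exact (hD.iIndepFun_sigma.indepFun hpq).comp
      (φ := fun x => (numSamples P X C α cα ε p.1 : ℝ)⁻¹ * x)
      (ψ := fun x => (numSamples P X C α cα ε q.1 : ℝ)⁻¹ * x) (by fun_prop) (by fun_prop)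

lemma variance_estimator_pos (h : RateAssumption P Xlim X C α β γ cα) (hD : IsSampling P X D)
    (hv : VarianceDecayAssumption P X C α β γ) (ε : ℝ) :
    0 < variance (estimator P X C α cα D ε) P := by
  rw [variance_estimator h hD]
  refine Finset.sum_pos' (fun ℓ _ => div_nonneg (levelVar_nonneg ℓ) (Nat.cast_nonneg _))
    ⟨0, by simp, div_pos hv.var_zero_pos (numSamples_cast_pos ..)⟩

/-- Summed over the levels, the main terms give exactly ε². The rounding errors involve the total
cost of one sample per level, a geometric sum dominated by e^{γL}, and are eventually at most ε²/2.
-/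
lemma eventually_le_variance_estimator (h : RateAssumption P Xlim X C α β γ cα)
    (hD : IsSampling P X D) (hβγ : β ≤ γ) (hv : VarianceDecayAssumption P X C α β γ) :
    ∀ᶠ ε : ℝ in 𝓝[>] 0, ε ^ 2 / 2 ≤ variance (estimator P X C α cα D ε) P := by
  obtain ⟨K, hK, hCK⟩ := h.exists_cost_le
  have h1 := (tendsto_sq_mul_exp_div_levelSum_sq h hβγ hv).const_mul
    (K * (1 - Real.exp (-γ))⁻¹)
  rw [mul_zero] at h1
  filter_upwards [h1.eventually_le_const (show (0 : ℝ) < 1 / 2 by norm_num),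
    self_mem_nhdsWithin] with ε hε hε0
  replace hε0 : 0 < ε := hε0
  rw [variance_estimator h hD]
  refine le_trans ?_ (Finset.sum_le_sum fun ℓ _ => levelVar_div_numSamples_ge h hv hε0 ℓ)
  have hS := levelSum_pos h hv (numLevels α cα ε)
  rw [Finset.sum_sub_distrib, ← Finset.sum_div, ← Finset.sum_div, ← Finset.mul_sum,
    ← Finset.mul_sum]
  have e1 : ∑ ℓ ∈ Finset.range (numLevels α cα ε + 1), Real.sqrt (levelVar P X ℓ * C ℓ)
    = levelSum P X C (numLevels α cα ε) := rfl
  have e2 : ∑ ℓ ∈ Finset.range (numLevels α cα ε + 1), C ℓ ≤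
      K * ((1 - Real.exp (-γ))⁻¹ * Real.exp (γ * numLevels α cα ε)) := by
    refine (Finset.sum_le_sum fun ℓ _ => hCK ℓ).trans ?_
    rw [← Finset.mul_sum]
    gcongr
    exact sum_exp_mul_le h.gamma_pos _
  rw [e1, mul_div_assoc, div_self hS.ne', mul_one]
  set S := levelSum P X C (numLevels α cα ε)
  have e3 : ε ^ 4 * (∑ ℓ ∈ Finset.range (numLevels α cα ε + 1), C ℓ) / S ^ 2 ≤
      ε ^ 2 * (1 / 2) := by
    calc _ ≤ ε ^ 4 * (K * ((1 - Real.exp (-γ))⁻¹ * Real.exp (γ * numLevels α cα ε))) / S ^ 2 := by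
          gcongr
      _ = ε ^ 2 * (K * (1 - Real.exp (-γ))⁻¹ *
            (ε ^ 2 * Real.exp (γ * numLevels α cα ε) / S ^ 2)) := by ring
      _ ≤ _ := by gcongr
  linarith

/-! ### Tail expectations of a single level. -/

section TailExpectation

lemma tailExpectation_eq (ℓ : ℕ) (hV : 0 < levelVar P X ℓ) (t : ℝ) :
    tailExpectation P X ℓ t = ∫ ω, Set.indicator (Set.Ioi t) id
      (|levelDiff X ℓ ω - ∫ ω', levelDiff X ℓ ω' ∂P| ^ 2 / levelVar P X ℓ) ∂P := by
  rw [tailExpectation, if_pos hV]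
  rfl

lemma tailExpectation_nonneg (ℓ : ℕ) (t : ℝ) : 0 ≤ tailExpectation P X ℓ t := by
  unfold tailExpectation
  split_ifs with hV
  · exact integral_nonneg fun ω => Set.indicator_nonneg (fun _ _ => by positivity) _
  · exact le_rfl

variable [IsProbabilityMeasure P]

lemma integrable_normalized_sq (h : RateAssumption P Xlim X C α β γ cα) (ℓ : ℕ) :
    Integrable (fun ω => |levelDiff X ℓ ω - ∫ ω', levelDiff X ℓ ω' ∂P| ^ 2 / levelVar P X ℓ) P := by
  simp_rw [sq_abs]
  exact ((memLp_levelDiff h ℓ).sub (memLp_const _)).integrable_sq.div_const _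

lemma aestronglyMeasurable_indicator_normalized_sq (h : RateAssumption P Xlim X C α β γ cα)
    (ℓ : ℕ) (t : ℝ) : AEStronglyMeasurable (fun ω => Set.indicator (Set.Ioi t) id
      (|levelDiff X ℓ ω - ∫ ω', levelDiff X ℓ ω' ∂P| ^ 2 / levelVar P X ℓ)) P :=
  ((measurable_id.indicator measurableSet_Ioi).comp_aemeasurable
    (integrable_normalized_sq h ℓ).aemeasurable).aestronglyMeasurable

lemma norm_indicator_Ioi_id_le {z : ℝ} (hz : 0 ≤ z) (t : ℝ) :
    ‖Set.indicator (Set.Ioi t) id z‖ ≤ z := by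
  by_cases h : z ∈ Set.Ioi t
  · rw [Set.indicator_of_mem h, id, Real.norm_of_nonneg hz]
  · rw [Set.indicator_of_notMem h, norm_zero]; exact hz

lemma tailExpectation_antitone (h : RateAssumption P Xlim X C α β γ cα) (ℓ : ℕ) :
    Antitone (tailExpectation P X ℓ) := by
  intro s t hst
  by_cases hV : 0 < levelVar P X ℓ
  · rw [tailExpectation_eq ℓ hV, tailExpectation_eq ℓ hV]
    have hint (r : ℝ) := (integrable_normalized_sq h ℓ).mono'
      (aestronglyMeasurable_indicator_normalized_sq h ℓ r)
      (ae_of_all _ fun ω => norm_indicator_Ioi_id_le (by positivity) r)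
    refine integral_mono (hint t) (hint s) fun ω => ?_
    refine Set.indicator_le_indicator_apply_of_subset (Set.Ioi_subset_Ioi hst) ?_
    exact div_nonneg (by positivity) hV.le
  · simp [tailExpectation, hV]

/-- Dominated convergence at a fixed level; this serves the coarse levels, about which the tail
hypothesis says nothing. -/
lemma tendsto_tailExpectation_atTop (h : RateAssumption P Xlim X C α β γ cα) (ℓ : ℕ) :
    Tendsto (tailExpectation P X ℓ) atTop (𝓝 0) := by
  by_cases hV : 0 < levelVar P X ℓ
  · simp_rw [funext (tailExpectation_eq (P := P) (X := X) ℓ hV)]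
    rw [← integral_zero Ω ℝ (μ := P)]
    refine tendsto_integral_filter_of_dominated_convergence _
      (Eventually.of_forall (aestronglyMeasurable_indicator_normalized_sq h ℓ))
      (Eventually.of_forall fun t => ae_of_all _ fun ω =>
        norm_indicator_Ioi_id_le (div_nonneg (by positivity) hV.le) t)
      (integrable_normalized_sq h ℓ) (ae_of_all _ fun ω => ?_)
    refine tendsto_const_nhds.congr' ?_
    filter_upwards [eventually_ge_atTop
      (|levelDiff X ℓ ω - ∫ ω', levelDiff X ℓ ω' ∂P| ^ 2 / levelVar P X ℓ)] with t ht
    rw [Set.indicator_of_notMem (by simpa using ht)]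
  · have : tailExpectation P X ℓ = fun _ => 0 := by ext t; simp [tailExpectation, hV]
    rw [this]
    exact tendsto_const_nhds

end TailExpectation

/-! ### Second moments and Lindeberg condition of the array. -/

section Array

lemma iIndepFun_array (hD : IsSampling P X D) (ε : ℝ) :
    iIndepFun (array P X C α cα D ε) P :=
  hD.iIndepFun_sigma.comp (fun p x => (x - ∫ ω', levelDiff X p.1 ω' ∂P) /
    (Real.sqrt (variance (estimator P X C α cα D ε) P) * numSamples P X C α cα ε p.1))
    (fun p => by fun_prop)

lemma integral_comp_array (hD : IsSampling P X D) (ε : ℝ) (p : (_ : ℕ) × ℕ) {f : ℝ → ℝ}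
    (hf : Measurable f) :
    ∫ ω, f (array P X C α cα D ε p ω) ∂P =
      ∫ ω, f ((levelDiff X p.1 ω - ∫ ω', levelDiff X p.1 ω' ∂P) /
        (Real.sqrt (variance (estimator P X C α cα D ε) P) * numSamples P X C α cα ε p.1)) ∂P :=
  ((hD.identDistrib p.1 p.2).comp (u := fun x => f ((x - ∫ ω', levelDiff X p.1 ω' ∂P) /
    (Real.sqrt (variance (estimator P X C α cα D ε) P) * numSamples P X C α cα ε p.1)))
    (by fun_prop)).integral_eq

lemma integral_array_sq (h : RateAssumption P Xlim X C α β γ cα) (hD : IsSampling P X D) (ε : ℝ)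
    (p : (_ : ℕ) × ℕ) : ∫ ω, array P X C α cα D ε p ω ^ 2 ∂P =
      levelVar P X p.1 / (variance (estimator P X C α cα D ε) P *
        (numSamples P X C α cα ε p.1 : ℝ) ^ 2) := by
  rw [integral_comp_array hD ε p (f := fun x => x ^ 2) (by fun_prop)]
  simp_rw [div_pow, mul_pow, Real.sq_sqrt (variance_nonneg (estimator P X C α cα D ε) P)]
  rw [integral_div, levelVar,
    variance_eq_integral (memLp_levelDiff h p.1).aestronglyMeasurable.aemeasurable]

/-- For positive level variance the right side is the reciprocal of an entry's second moment. The
bound thus serves both the maximum condition and the truncation thresholds. -/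
lemma levelSum_sq_div_le (h : RateAssumption P Xlim X C α β γ cα) {ε : ℝ} (hε : 0 < ε)
    (hvar : ε ^ 2 / 2 ≤ variance (estimator P X C α cα D ε) P) {ℓ : ℕ}
    (hV : 0 < levelVar P X ℓ) :
    levelSum P X C (numLevels α cα ε) ^ 2 / (2 * ε ^ 2 * C ℓ) ≤
      variance (estimator P X C α cα D ε) P *
        (numSamples P X C α cα ε ℓ : ℝ) ^ 2 / levelVar P X ℓ := by
  have h1 := sq_le_numSamples_sq h ε ℓ
  have hC := h.cost_pos ℓ
  rw [le_div_iff₀ hV]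
  calc _ = ε ^ 2 / 2 * (levelVar P X ℓ * levelSum P X C (numLevels α cα ε) ^ 2 /
        (ε ^ 4 * C ℓ)) := by field_simp
    _ ≤ _ := mul_le_mul hvar h1 (by positivity) (variance_nonneg _ _)

lemma sum_integral_array_sq (h : RateAssumption P Xlim X C α β γ cα) (hD : IsSampling P X D)
    (hv : VarianceDecayAssumption P X C α β γ) (ε : ℝ) :
    ∑ p ∈ arrayIndex P X C α cα ε, ∫ ω, array P X C α cα D ε p ω ^ 2 ∂P = 1 := by
  have hpos := variance_estimator_pos (C := C) (α := α) (cα := cα) h hD hv ε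
  simp_rw [integral_array_sq h hD]
  rw [sum_arrayIndex_fst ε (fun ℓ => levelVar P X ℓ / (variance (estimator P X C α cα D ε) P *
        (numSamples P X C α cα ε ℓ : ℝ) ^ 2))]
  have e (ℓ : ℕ) : (numSamples P X C α cα ε ℓ : ℝ) *
      (levelVar P X ℓ / (variance (estimator P X C α cα D ε) P *
        (numSamples P X C α cα ε ℓ : ℝ) ^ 2)) =
      levelVar P X ℓ / numSamples P X C α cα ε ℓ / variance (estimator P X C α cα D ε) P := by
    have := numSamples_cast_pos P X C α cα ε ℓ
    field_simp
  simp_rw [e]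
  rw [← Finset.sum_div, ← variance_estimator h hD, div_self hpos.ne']

lemma tendsto_iSup_integral_array_sq (h : RateAssumption P Xlim X C α β γ cα)
    (hD : IsSampling P X D) (hβγ : β ≤ γ) (hv : VarianceDecayAssumption P X C α β γ) :
    Tendsto (fun ε : ℝ => ⨆ m : arrayIndex P X C α cα ε, ∫ ω, array P X C α cα D ε m ω ^ 2 ∂P)
      (𝓝[>] 0) (𝓝 0) := by
  obtain ⟨K, hK, hCK⟩ := h.exists_cost_le
  have h1 := (tendsto_sq_mul_exp_div_levelSum_sq h hβγ hv).const_mul (2 * K)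
  rw [mul_zero] at h1
  refine squeeze_zero' (Eventually.of_forall fun ε => Real.iSup_nonneg fun m =>
    integral_nonneg fun ω => sq_nonneg _) ?_ h1
  filter_upwards [eventually_le_variance_estimator h hD hβγ hv, self_mem_nhdsWithin]
    with ε hvar hε
  replace hε : 0 < ε := hε
  have hS := levelSum_pos h hv (numLevels α cα ε)
  refine Real.iSup_le (fun ⟨p, hp⟩ => ?_) (by positivity)
  rw [integral_array_sq h hD]
  rcases (levelVar_nonneg (P := P) (X := X) p.1).eq_or_lt with hV | hV
  · rw [← hV, zero_div]
    positivity
  · have h2 := levelSum_sq_div_le h hε hvar hV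
    have hC := h.cost_pos p.1
    have hpL : p.1 ≤ numLevels α cα ε := by
      have := (Finset.mem_sigma.1 hp).1
      simpa [Nat.lt_succ_iff] using this
    rw [← inv_div]
    refine (inv_anti₀ (by positivity) h2).trans ?_
    rw [inv_div]
    have h3 : C p.1 ≤ K * Real.exp (γ * numLevels α cα ε) := by
      refine (hCK p.1).trans ?_
      have := h.gamma_pos
      gcongr
    calc 2 * ε ^ 2 * C p.1 / levelSum P X C (numLevels α cα ε) ^ 2
        ≤ 2 * ε ^ 2 * (K * Real.exp (γ * numLevels α cα ε)) /
          levelSum P X C (numLevels α cα ε) ^ 2 := by gcongr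
      _ = _ := by ring

/-- The truncation thresholds of the levels dominate `κ e^{2 α L(ε) - γ ℓ} S_{L(ε)}²`. -/
lemma exists_threshold_ge (h : RateAssumption P Xlim X C α β γ cα) (hD : IsSampling P X D)
    (hβγ : β ≤ γ) (hv : VarianceDecayAssumption P X C α β γ) {η : ℝ} (hη : 0 < η) :
    ∃ κ : ℝ, 0 < κ ∧ ∀ᶠ ε : ℝ in 𝓝[>] 0, ∀ ℓ, 0 < levelVar P X ℓ →
      κ * Real.exp (2 * α * numLevels α cα ε - γ * ℓ) * levelSum P X C (numLevels α cα ε) ^ 2 ≤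
        η ^ 2 * (variance (estimator P X C α cα D ε) P *
          (numSamples P X C α cα ε ℓ : ℝ) ^ 2) / levelVar P X ℓ := by
  obtain ⟨K, hK, hCK⟩ := h.exists_cost_le
  have hcα := h.calpha_pos
  -- The constant comes from inserting ε² ≤ (cα e^α)² e^{-2αL} and C_ℓ ≤ K e^{γℓ} into η² S_L² / (2
  -- ε² C_ℓ).
  refine ⟨η ^ 2 / (2 * (cα * Real.exp α) ^ 2 * K), by positivity, ?_⟩
  filter_upwards [eventually_le_variance_estimator h hD hβγ hv, Ioc_mem_nhdsGT h.calpha_pos]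
    with ε hvar hε ℓ hV
  have h2 := levelSum_sq_div_le h hε.1 hvar hV
  have h3 := le_mul_exp_neg_numLevels h.alpha_pos h.calpha_pos hε.1 hε.2
  have hC := h.cost_pos ℓ
  have hS := levelSum_pos h hv (numLevels α cα ε)
  have hε0 := hε.1
  set L := numLevels α cα ε
  set S := levelSum P X C L
  rw [mul_div_assoc]
  refine le_trans ?_ (mul_le_mul_of_nonneg_left h2 (sq_nonneg η))
  have h4 : ε ^ 2 ≤ (cα * Real.exp α) ^ 2 * Real.exp (-(2 * α * L)) := by
    calc ε ^ 2 ≤ (cα * Real.exp α * Real.exp (-(α * L))) ^ 2 := pow_le_pow_left₀ hε.1.le h3 2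
      _ = _ := by rw [mul_pow _ (Real.exp (-(α * L))), ← Real.exp_nat_mul]; congr 2; push_cast; ring
  have h5 : 2 * ε ^ 2 * C ℓ ≤ 2 * ((cα * Real.exp α) ^ 2 * Real.exp (-(2 * α * L))) *
      (K * Real.exp (γ * ℓ)) := by
    have := hCK ℓ
    gcongr
  have h6 : S ^ 2 / (2 * ((cα * Real.exp α) ^ 2 * Real.exp (-(2 * α * L))) *
      (K * Real.exp (γ * ℓ))) ≤ S ^ 2 / (2 * ε ^ 2 * C ℓ) := by gcongr
  refine le_trans (le_of_eq ?_) (mul_le_mul_of_nonneg_left h6 (sq_nonneg η))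
  rw [Real.exp_sub, Real.exp_neg]
  field_simp

variable [IsProbabilityMeasure P]

lemma normalizedEstimator_eq_sum_array (h : RateAssumption P Xlim X C α β γ cα) (ε : ℝ) (ω : Ω) :
    normalizedEstimator P X C α cα D ε ω =
      ∑ m ∈ arrayIndex P X C α cα ε, array P X C α cα D ε m ω := by
  have e (p : (_ : ℕ) × ℕ) : array P X C α cα D ε p ω =
      ((numSamples P X C α cα ε p.1 : ℝ)⁻¹ * D p.1 p.2 ω
        - (numSamples P X C α cα ε p.1 : ℝ)⁻¹ * ∫ ω', levelDiff X p.1 ω' ∂P)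
        / Real.sqrt (variance (estimator P X C α cα D ε) P) := by
    rw [array, ← mul_sub, ← div_div, div_right_comm, inv_mul_eq_div]
  simp_rw [e]
  rw [← Finset.sum_div, Finset.sum_sub_distrib, sum_arrayIndex_fst ε
    (fun ℓ => (numSamples P X C α cα ε ℓ : ℝ)⁻¹ * ∫ ω', levelDiff X ℓ ω' ∂P)]
  have e2 : ∑ ℓ ∈ Finset.range (numLevels α cα ε + 1), (numSamples P X C α cα ε ℓ : ℝ) *
      ((numSamples P X C α cα ε ℓ : ℝ)⁻¹ * ∫ ω', levelDiff X ℓ ω' ∂P) =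
        ∫ ω', X (numLevels α cα ε) ω' ∂P := by
    rw [← sum_integral_levelDiff h]
    refine Finset.sum_congr rfl fun ℓ _ => ?_
    rw [mul_inv_cancel_left₀ (numSamples_cast_pos P X C α cα ε ℓ).ne']
  rw [e2, normalizedEstimator, congrFun (estimator_eq_sum_arrayIndex ε) ω, Finset.sum_apply]

lemma memLp_array (h : RateAssumption P Xlim X C α β γ cα) (hD : IsSampling P X D) (ε : ℝ)
    (p : (_ : ℕ) × ℕ) : MemLp (array P X C α cα D ε p) 2 P := by
  unfold array
  simp_rw [div_eq_inv_mul]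
  exact ((hD.memLp h p.1 p.2).sub (memLp_const _)).const_mul _

lemma integral_array (h : RateAssumption P Xlim X C α β γ cα) (hD : IsSampling P X D) (ε : ℝ)
    (p : (_ : ℕ) × ℕ) : ∫ ω, array P X C α cα D ε p ω ∂P = 0 := by
  simp only [array]
  rw [integral_div, integral_sub ((hD.memLp h p.1 p.2).integrable (by norm_num))
    (integrable_const _), (hD.identDistrib p.1 p.2).integral_eq]
  simp

/-- The truncated second moments of the array in terms of the tail expectations of the levels. -/
lemma integral_indicator_array_sq (h : RateAssumption P Xlim X C α β γ cα)
    (hD : IsSampling P X D) (hv : VarianceDecayAssumption P X C α β γ) (ε : ℝ)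
    (p : (_ : ℕ) × ℕ) {η : ℝ} (hη : 0 < η) :
    ∫ ω, Set.indicator {z : ℝ | η < |z|} (fun z => z ^ 2) (array P X C α cα D ε p ω) ∂P =
      levelVar P X p.1 / (variance (estimator P X C α cα D ε) P *
        (numSamples P X C α cα ε p.1 : ℝ) ^ 2) *
      tailExpectation P X p.1 (η ^ 2 * (variance (estimator P X C α cα D ε) P *
        (numSamples P X C α cα ε p.1 : ℝ) ^ 2) / levelVar P X p.1) := by
  have hpos := variance_estimator_pos (C := C) (α := α) (cα := cα) h hD hv ε
  have hM := numSamples_cast_pos P X C α cα ε p.1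
  rw [integral_comp_array hD ε p (f := Set.indicator {z : ℝ | η < |z|} (fun z => z ^ 2))
    (Measurable.indicator (by fun_prop) (measurableSet_lt measurable_const (by fun_prop)))]
  set v := variance (estimator P X C α cα D ε) P
  set M : ℝ := ((numSamples P X C α cα ε p.1 : ℕ) : ℝ)
  obtain ⟨r, hr0, hr⟩ : ∃ r : ℝ, 0 < r ∧ v * M ^ 2 = r ^ 2 :=
    ⟨Real.sqrt v * M, by positivity, by rw [mul_pow, Real.sq_sqrt hpos.le]⟩
  have hr' : Real.sqrt v * M = r := by
    rw [← Real.sqrt_sq hr0.le, ← hr, Real.sqrt_mul hpos.le, Real.sqrt_sq hM.le]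
  rw [hr, hr']
  rcases (levelVar_nonneg (P := P) (X := X) p.1).eq_or_lt with hV | hV
  -- A level of variance zero is almost surely constant, so the left side vanishes too.
  · rw [← hV, zero_div, zero_mul]
    refine integral_eq_zero_of_ae ?_
    filter_upwards [ae_eq_integral_of_variance_eq_zero (memLp_levelDiff h p.1) hV.symm] with ω hω
    rw [hω]
    simp
  · rw [tailExpectation_eq p.1 hV, ← integral_const_mul]
    refine integral_congr_ae (ae_of_all _ fun ω => ?_)
    beta_reduce
    generalize levelDiff X p.1 ω - ∫ ω', levelDiff X p.1 ω' ∂P = x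
    have hiff : η < |x / r| ↔ η ^ 2 * r ^ 2 / levelVar P X p.1 < |x| ^ 2 / levelVar P X p.1 := by
      rw [abs_div, abs_of_pos hr0, lt_div_iff₀ hr0, div_lt_div_iff_of_pos_right hV, ← mul_pow,
        pow_lt_pow_iff_left₀ (by positivity) (abs_nonneg x) two_ne_zero]
    by_cases hx : η < |x / r|
    · rw [Set.indicator_of_mem (by exact hx), Set.indicator_of_mem (by exact hiff.1 hx), id, sq_abs]
      field_simp
    · rw [Set.indicator_of_notMem (by exact hx), Set.indicator_of_notMem (by exact mt hiff.2 hx),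
        mul_zero]

lemma sum_integral_indicator_array_sq (h : RateAssumption P Xlim X C α β γ cα)
    (hD : IsSampling P X D) (hv : VarianceDecayAssumption P X C α β γ) (ε : ℝ)
    {η : ℝ} (hη : 0 < η) :
    ∑ p ∈ arrayIndex P X C α cα ε,
      ∫ ω, Set.indicator {z : ℝ | η < |z|} (fun z => z ^ 2) (array P X C α cα D ε p ω) ∂P =
    ∑ ℓ ∈ Finset.range (numLevels α cα ε + 1),
      levelVar P X ℓ / numSamples P X C α cα ε ℓ / variance (estimator P X C α cα D ε) P *
      tailExpectation P X ℓ (η ^ 2 * (variance (estimator P X C α cα D ε) P *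
        (numSamples P X C α cα ε ℓ : ℝ) ^ 2) / levelVar P X ℓ) := by
  simp_rw [integral_indicator_array_sq h hD hv ε _ hη]
  rw [sum_arrayIndex_fst ε (fun ℓ => levelVar P X ℓ / (variance (estimator P X C α cα D ε) P *
        (numSamples P X C α cα ε ℓ : ℝ) ^ 2) *
      tailExpectation P X ℓ (η ^ 2 * (variance (estimator P X C α cα D ε) P *
        (numSamples P X C α cα ε ℓ : ℝ) ^ 2) / levelVar P X ℓ))]
  refine Finset.sum_congr rfl fun ℓ _ => ?_
  rw [← mul_assoc]
  congr 1
  have := numSamples_cast_pos P X C α cα ε ℓ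
  have := variance_estimator_pos (C := C) (α := α) (cα := cα) h hD hv ε
  field_simp

lemma tendsto_sum_integral_indicator_array_sq (h : RateAssumption P Xlim X C α β γ cα)
    (hD : IsSampling P X D) (hβγ : β ≤ γ) (hv : VarianceDecayAssumption P X C α β γ)
    (htail : ∀ ν : ℝ, 0 < ν → Tendsto (fun ℓ : ℕ => tailExpectation P X ℓ
        (Real.exp ((2 * α - γ) * ℓ) * levelSum P X C ℓ ^ 2 * ν)) atTop (𝓝 0))
    {η : ℝ} (hη : 0 < η) :
    Tendsto (fun ε : ℝ => ∑ p ∈ arrayIndex P X C α cα ε,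
      ∫ ω, Set.indicator {z : ℝ | η < |z|} (fun z => z ^ 2) (array P X C α cα D ε p ω) ∂P)
      (𝓝[>] 0) (𝓝 0) := by
  obtain ⟨κ, hκ, hthr⟩ := exists_threshold_ge (D := D) (cα := cα) h hD hβγ hv hη
  refine (nhds_basis_abs_sub_lt (0 : ℝ)).tendsto_right_iff.2 fun δ hδ => ?_
  -- `ℓ₀` separates coarse from fine levels and does not depend on ε.
  obtain ⟨ℓ₀, hℓ₀⟩ := eventually_atTop.1 ((htail κ hκ).eventually_lt_const (half_pos hδ))
  have hS0 := levelSum_zero_pos h hv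
  have hα := h.alpha_pos
  -- On coarse levels S_L is replaced by the positive constant S_0; the factor e^{2αL} alone drives
  -- the threshold to infinity.
  have hfix : Tendsto (fun ε : ℝ => ∑ ℓ ∈ Finset.range ℓ₀, tailExpectation P X ℓ
      (κ * Real.exp (2 * α * numLevels α cα ε - γ * ℓ) * levelSum P X C 0 ^ 2))
      (𝓝[>] 0) (𝓝 0) := by
    rw [show 𝓝 (0 : ℝ) = 𝓝 (∑ _ℓ ∈ Finset.range ℓ₀, 0) by simp]
    refine tendsto_finsetSum _ fun ℓ _ => (tendsto_tailExpectation_atTop h ℓ).comp ?_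
    refine Tendsto.atTop_mul_const (by positivity) (Tendsto.const_mul_atTop hκ ?_)
    refine Real.tendsto_exp_atTop.comp (tendsto_atTop_add_const_right _ _ ?_)
    exact (tendsto_natCast_atTop_atTop.comp
      (tendsto_numLevels h.alpha_pos h.calpha_pos)).const_mul_atTop (by positivity)
  filter_upwards [hthr, hfix.eventually_lt_const (half_pos hδ)] with ε hε hsum
  rw [sub_zero, abs_of_nonneg (Finset.sum_nonneg fun p _ => integral_nonneg fun ω =>
    Set.indicator_nonneg (fun z _ => sq_nonneg z) _), sum_integral_indicator_array_sq h hD hv ε hη]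
  have hpos := variance_estimator_pos (C := C) (α := α) (cα := cα) h hD hv ε
  set L := numLevels α cα ε
  set v := variance (estimator P X C α cα D ε) P
  set w : ℕ → ℝ := fun ℓ => levelVar P X ℓ / numSamples P X C α cα ε ℓ / v with hw
  have hw0 ℓ : 0 ≤ w ℓ :=
    div_nonneg (div_nonneg (levelVar_nonneg ℓ) (Nat.cast_nonneg _)) hpos.le
  have hw1 : ∑ ℓ ∈ Finset.range (L + 1), w ℓ = 1 := by
    rw [hw, ← Finset.sum_div, ← variance_estimator h hD, div_self hpos.ne']
  set τ : ℕ → ℝ := fun ℓ => tailExpectation P X ℓ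
      (κ * Real.exp (2 * α * L - γ * ℓ) * levelSum P X C 0 ^ 2) with hτ
  have hτ0 ℓ : 0 ≤ τ ℓ := tailExpectation_nonneg ℓ _
  -- Coarse levels use only that the weight is at most 1. Fine levels keep their weights, whose
  -- total is 1, so together they contribute at most δ/2 however large L is.
  have hterm : ∀ ℓ ∈ Finset.range (L + 1), w ℓ * tailExpectation P X ℓ (η ^ 2 * (v *
        (numSamples P X C α cα ε ℓ : ℝ) ^ 2) / levelVar P X ℓ) ≤
      (if ℓ < ℓ₀ then τ ℓ else 0) + w ℓ * (δ / 2) := by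
    intro ℓ hℓ
    have hℓL : ℓ ≤ L := Nat.lt_succ_iff.1 (Finset.mem_range.1 hℓ)
    rcases (levelVar_nonneg (P := P) (X := X) ℓ).eq_or_lt with hV | hV
    · have : w ℓ = 0 := by simp [hw, ← hV]
      rw [this, zero_mul, zero_mul, add_zero]
      split_ifs
      exacts [hτ0 ℓ, le_rfl]
    · have hge := hε ℓ hV
      split_ifs with hlt
      · have h1 : tailExpectation P X ℓ (η ^ 2 * (v *
            (numSamples P X C α cα ε ℓ : ℝ) ^ 2) / levelVar P X ℓ) ≤ τ ℓ := by
          refine tailExpectation_antitone h ℓ (le_trans ?_ hge)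
          have := levelSum_mono (P := P) (X := X) (C := C) (Nat.zero_le L)
          gcongr
        have h2 : w ℓ ≤ 1 := hw1 ▸ Finset.single_le_sum (fun j _ => hw0 j) hℓ
        have h3 := mul_le_mul h2 h1 (tailExpectation_nonneg ℓ _) zero_le_one
        have h4 : 0 ≤ w ℓ * (δ / 2) := mul_nonneg (hw0 ℓ) (half_pos hδ).le
        linarith
      · rw [zero_add]
        refine mul_le_mul_of_nonneg_left (le_trans ?_ (hℓ₀ ℓ (not_lt.1 hlt)).le) (hw0 ℓ)
        refine tailExpectation_antitone h ℓ (le_trans ?_ hge)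
        have h1 := levelSum_mono (P := P) (X := X) (C := C) hℓL
        have h2 := levelSum_nonneg (P := P) (X := X) (C := C) ℓ
        -- Replacing L by ℓ ≤ L lowers the threshold to the one in the tail hypothesis, since α > 0.
        have h3 : (2 * α - γ) * ℓ ≤ 2 * α * L - γ * ℓ := by
          have : (ℓ : ℝ) ≤ L := by exact_mod_cast hℓL
          nlinarith
        calc Real.exp ((2 * α - γ) * ℓ) * levelSum P X C ℓ ^ 2 * κ
            = κ * Real.exp ((2 * α - γ) * ℓ) * levelSum P X C ℓ ^ 2 := by ring
          _ ≤ _ := by gcongr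
  refine (Finset.sum_le_sum hterm).trans_lt ?_
  rw [Finset.sum_add_distrib, ← Finset.sum_mul, hw1, one_mul, ← Finset.sum_filter]
  have hsub : ∑ ℓ ∈ (Finset.range (L + 1)).filter (· < ℓ₀), τ ℓ ≤ ∑ ℓ ∈ Finset.range ℓ₀, τ ℓ :=
    Finset.sum_le_sum_of_subset_of_nonneg
      (fun ℓ hℓ => Finset.mem_range.2 (Finset.mem_filter.1 hℓ).2) fun ℓ _ _ => hτ0 ℓ
  linarith

end Array

end MLMC

/-! ### The central limit theorem for the estimator. -/

theorem theorem4 {Ω : Type*} [MeasurableSpace Ω] (P : Measure Ω) [IsProbabilityMeasure P]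
    (Xlim : Ω → ℝ) (X : ℕ → Ω → ℝ) (C : ℕ → ℝ) (α β γ cα : ℝ) (D : ℕ → ℕ → Ω → ℝ)
    (hrate : MLMC.RateAssumption P Xlim X C α β γ cα)
    (hD : MLMC.IsSampling P X D)
    (hβγ : β ≤ γ)
    (hvar : MLMC.VarianceDecayAssumption P X C α β γ)
    (htail : ∀ ν : ℝ, 0 < ν →
      Tendsto (fun ℓ : ℕ => MLMC.tailExpectation P X ℓ
        (Real.exp ((2 * α - γ) * ℓ) * MLMC.levelSum P X C ℓ ^ 2 * ν)) atTop (𝓝 0)) :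
    (∀ ε : ℝ, 0 < ε → ∀ ω : Ω, MLMC.normalizedEstimator P X C α cα D ε ω =
      ∑ m ∈ MLMC.arrayIndex P X C α cα ε, MLMC.array P X C α cα D ε m ω) ∧
    MLMC.ExtendedCLT P (MLMC.arrayIndex P X C α cα) (MLMC.array P X C α cα D) := by
  refine ⟨fun ε _ ω => MLMC.normalizedEstimator_eq_sum_array hrate ε ω, ?_, ?_⟩
  · exact MLMC.tendstoInDistribution_sum_of_lindeberg _ (MLMC.memLp_array hrate hD)
      (MLMC.integral_array hrate hD) (MLMC.iIndepFun_array hD)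
      (Eventually.of_forall (MLMC.sum_integral_array_sq hrate hD hvar))
      (fun η hη => MLMC.tendsto_sum_integral_indicator_array_sq hrate hD hβγ hvar htail hη)
  · exact MLMC.tendsto_iSup_integral_array_sq hrate hD hβγ hvar
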